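/- Let $a>1$ be real, let $\Gamma$ be the Gamma function, $\zeta$ the Riemann zeta function (analytically continued), and $\gamma$ the Euler–Mascheroni constant. Then the series $$\sum_{k=1}^{\infty}\Gamma\!\left(\frac{2\pi i k}{\ln a}\right)\zeta\!\left(\frac{2\pi i k}{\ln a}\right),\qquad \sum_{k=0}^{\infty}\frac{1}{e^{a^k}-1},\qquad \sum_{k=1}^{\infty}\left(\coth\!\left(\frac{a^{-k}}{2}\right)-2a^{k}\right)$$ converge absolutely, and $$\Re\sum_{k=1}^{\infty}\Gamma\!\left(\frac{2\pi i k}{\ln a}\right)\zeta\!\left(\frac{2\pi i k}{\ln a}\right)= -\frac{a\ln a}{2(a-1)}-\frac{\gamma-\ln(2\pi\sqrt a)}{4}+\frac{\ln a}{2}\sum_{k=0}^{\infty}\frac{1}{e^{a^k}-1}+\frac{\ln a}{4}\sum_{k=1}^{\infty}\left(\coth\!\left(\frac{a^{-k}}{2}\right)-2a^{k}\right).$$ -/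

import Mathlib

/-- The hyperbolic cotangent of a real number. -/
noncomputable def realCoth (x : ℝ) : ℝ := Real.cosh x / Real.sinh x

/-- The term `Γ(2πik / ln a) ζ(2πik / ln a)`. -/
noncomputable def gammaZetaTerm (a : ℝ) (k : ℕ) : ℂ :=
  Complex.Gamma (2 * (Real.pi : ℂ) * Complex.I * (k : ℂ) / (Real.log a : ℂ)) *
    riemannZeta (2 * (Real.pi : ℂ) * Complex.I * (k : ℂ) / (Real.log a : ℂ))

/-! The identity is Poisson summation in the variable `u = -log x / L`, with `L = log a`. The Mellin
transform of `1 / (eˣ - 1)` is `Γ ζ`, so sampling `Γ ζ` at `2πik / L` should amount to summing `1 /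
(eˣ - 1)` over the powers `x = a^(-n)`. That sum diverges as `x → 0` because of the terms `1 / x - 1
/ 2`, and `Γ ζ` has a double pole at `0`.

Both defects are cured by `regPlanck`: subtract `1 / x` everywhere, and add back `1 / 2` times a
cutoff equal to `min 1 u` clamped below at `0`. The ramp is continuous, as Poisson summation
requires. Its slope is the indicator of a unit interval in `u`, whose Fourier transform vanishes at
nonzero integers, so the coefficients there are exactly `Γ ζ` (`mellin_regPlanck_of_exp_eq_one`).
The zeroth coefficient supplies `γ`, `log (2π)` and `L / 4` (`mellin_regPlanck_zero`).

At integers the ramp is `0` or `1`, so the lattice sum splits into the series at `a^k`, a geometric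
series, and the `coth` series (`tsum_regPlanck_exp_eq`). -/

open Filter Topology MeasureTheory Set FourierTransform

/-! ### Elementary estimates for `1 / (eˣ - 1)`. -/

/-- The function `1 / (eˣ - 1)`. -/
noncomputable def planck (x : ℝ) : ℝ := 1 / (Real.exp x - 1)

lemma planck_nonneg {x : ℝ} (hx : 0 < x) : 0 ≤ planck x := by
  have := Real.add_one_lt_exp hx.ne'
  unfold planck
  have : 0 < Real.exp x - 1 := by linarith
  positivity

lemma planck_le_inv {x : ℝ} (hx : 0 < x) : planck x ≤ x⁻¹ := by
  have := Real.add_one_lt_exp hx.ne'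
  unfold planck
  rw [one_div]
  exact inv_anti₀ hx (by linarith)

lemma abs_planck_sub_inv_add_half_le {x : ℝ} (hx : 0 < x) (hx1 : x ≤ 1) :
    |planck x - x⁻¹ + 1 / 2| ≤ x := by
  have h1 := Real.add_one_lt_exp hx.ne'
  have hE : 0 < Real.exp x - 1 := by linarith
  -- Third-order Taylor remainder, with constant `4 / (3! * 3) = 2 / 9`; the numerator of `key` is
  -- then `O(x³)`.
  have hb := Real.exp_bound (x := x) (by rwa [abs_of_pos hx]) (n := 3) (by norm_num)
  rw [abs_of_pos hx] at hb
  norm_num [Finset.sum_range_succ, Nat.factorial] at hb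
  have key : planck x - x⁻¹ + 1 / 2 =
      (2 * x + (x - 2) * (Real.exp x - 1)) / (2 * x * (Real.exp x - 1)) := by
    unfold planck; field_simp; ring
  rw [key, abs_div, abs_of_pos (by positivity : 0 < 2 * x * (Real.exp x - 1)),
    div_le_iff₀ (by positivity)]
  obtain ⟨r, hr⟩ : ∃ r, r = Real.exp x - (1 + x + x ^ 2 / 2) := ⟨_, rfl⟩
  have hE' : Real.exp x - 1 = x + x ^ 2 / 2 + r := by rw [hr]; ring
  rw [← hr] at hb
  have h3 : 0 < x ^ 3 := by positivity
  have hnum : 2 * x + (x - 2) * (Real.exp x - 1) = x ^ 3 / 2 + (x - 2) * r := by rw [hE']; ring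
  have hr2 : |(x - 2) * r| ≤ 2 * (x ^ 3 * (2 / 9)) := by
    rw [abs_mul]
    exact mul_le_mul (by rw [abs_le]; constructor <;> linarith) hb (abs_nonneg _) (by norm_num)
  calc |2 * x + (x - 2) * (Real.exp x - 1)| ≤ |x ^ 3 / 2| + |(x - 2) * r| := by
        rw [hnum]; exact abs_add_le _ _
    _ ≤ x ^ 3 / 2 + 2 * (x ^ 3 * (2 / 9)) := by rw [abs_of_pos (by positivity)]; gcongr
    _ ≤ x * (2 * x * x) := by nlinarith
    _ ≤ x * (2 * x * (Real.exp x - 1)) := by gcongr; linarith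

lemma continuousOn_planck : ContinuousOn planck (Ioi 0) := by
  unfold planck
  refine continuousOn_const.div (by fun_prop) fun x hx => ?_
  have := Real.add_one_lt_exp (ne_of_gt hx)
  have : (0 : ℝ) < x := hx
  linarith

lemma hasSum_planck {x : ℝ} (hx : 0 < x) :
    HasSum (fun n : ℕ => Real.exp (-(n + 1) * x)) (planck x) := by
  have h1 : Real.exp (-x) < 1 := by simpa using hx
  have h := (hasSum_geometric_of_lt_one (Real.exp_pos (-x)).le h1).mul_left (Real.exp (-x))
  convert! h using 1
  · ext n
    rw [← Real.exp_nat_mul, ← Real.exp_add]; ring_nf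
  · have := Real.add_one_lt_exp hx.ne'
    have h2 : Real.exp x - 1 ≠ 0 := by linarith
    rw [planck, Real.exp_neg]
    have h3 : 1 - (Real.exp x)⁻¹ ≠ 0 := by rw [← Real.exp_neg]; linarith
    field_simp

lemma realCoth_half {x : ℝ} (hx : 0 < x) : realCoth (x / 2) = 2 * planck x + 1 := by
  have h := Real.add_one_lt_exp hx.ne'
  have hE : Real.exp x - 1 ≠ 0 := by linarith
  have he : Real.exp x = Real.exp (x / 2) * Real.exp (x / 2) := by rw [← Real.exp_add]; ring_nf
  have hp := Real.exp_pos (x / 2)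
  unfold realCoth planck
  rw [Real.cosh_eq, Real.sinh_eq, Real.exp_neg]
  have h5 : Real.exp (x / 2) - (Real.exp (x / 2))⁻¹ ≠ 0 := by
    have : (1 : ℝ) < Real.exp (x / 2) := by simpa using hx
    have := inv_lt_one_of_one_lt₀ this
    linarith
  rw [he] at hE ⊢
  have h6 : Real.exp (x / 2) ^ 2 - 1 ≠ 0 := by rw [sq]; exact hE
  field_simp
  ring

lemma mellin_planck {s : ℂ} (hs : 1 < s.re) :
    mellin (fun x => (planck x : ℂ)) s = Complex.Gamma s * riemannZeta s := by
  have hs0 : 0 < s.re := by linarith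
  have := hasSum_mellin (a := fun _ : ℕ => (1 : ℂ)) (p := fun n : ℕ => (n + 1 : ℝ))
    (F := fun x => (planck x : ℂ)) (s := s) (fun i => Or.inr (by positivity)) hs0
    (fun t ht => by
      have := Complex.hasSum_ofReal.mpr (hasSum_planck (x := t) ht)
      simpa using this)
    (by
      have h := (summable_nat_add_iff 1).mpr (Real.summable_one_div_nat_rpow.mpr hs)
      simpa using h)
  rw [← this.tsum_eq, zeta_eq_tsum_one_div_nat_add_one_cpow hs, ← tsum_mul_left]
  simp [div_eq_mul_inv]

/-! ### Bounds for `ζ` on `1 ≤ re s` and decay of `Γ ζ` on the imaginary axis. -/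

/-- In `ζ(s) = s ∫ ⌊t⌋ t^(-s-1)` over `t > 1`, write `⌊t⌋ = t + (⌊t⌋ - t)`: the first part gives `s
/ (s - 1)`, the second an integral of norm at most `1 / re s ≤ 1`. The bound does not degenerate at
the line `re s = 1` away from `s = 1`, so it passes to the limit there. -/
lemma norm_riemannZeta_le_of_one_lt_re {s : ℂ} (hs : 1 < s.re) :
    ‖riemannZeta s‖ ≤ ‖s‖ + ‖s‖ / ‖s - 1‖ := by
  have hs0 : 0 < s.re := by linarith
  have hs1 : s - 1 ≠ 0 := by
    intro h; rw [sub_eq_zero] at h; rw [h] at hs; simp at hs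
  have hL := LSeries_eq_mul_integral (fun _ => 1) zero_le_one hs
    (LSeriesSummable_one_iff.mpr hs) (by
      refine Asymptotics.isBigO_of_le _ fun n => ?_
      simp)
  have hz : riemannZeta s = s * ∫ t in Ioi (1 : ℝ), (⌊t⌋₊ : ℂ) * (t : ℂ) ^ (-(s + 1)) := by
    rw [← LSeries_one_eq_riemannZeta hs]
    convert! hL using 5
    simp
  have hi1 : IntegrableOn (fun t : ℝ => (t : ℂ) ^ (-s)) (Ioi 1) :=
    integrableOn_Ioi_cpow_of_lt (by simpa using hs) zero_lt_one
  have hbd : IntegrableOn (fun t : ℝ => t ^ (-(s.re + 1))) (Ioi 1) :=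
    integrableOn_Ioi_rpow_of_lt (by linarith) zero_lt_one
  have hnorm : ∀ t ∈ Ioi (1 : ℝ),
      ‖((⌊t⌋₊ : ℂ) - t) * (t : ℂ) ^ (-(s + 1))‖ ≤ t ^ (-(s.re + 1)) := by
    intro t ht
    have ht0 : (0 : ℝ) < t := lt_trans zero_lt_one ht
    rw [norm_mul, Complex.norm_cpow_eq_rpow_re_of_pos ht0]
    have h1 : ‖(⌊t⌋₊ : ℂ) - t‖ ≤ 1 := by
      rw [← Complex.ofReal_natCast, ← Complex.ofReal_sub, Complex.norm_real, Real.norm_eq_abs,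
        abs_le]
      have := Nat.floor_le ht0.le
      have := Nat.lt_floor_add_one t
      constructor <;> linarith
    have h2 : (-(s + 1)).re = -(s.re + 1) := by simp
    rw [h2]
    exact mul_le_of_le_one_left (by positivity) h1
  have hi2 : IntegrableOn (fun t : ℝ => ((⌊t⌋₊ : ℂ) - t) * (t : ℂ) ^ (-(s + 1))) (Ioi 1) := by
    refine Integrable.mono' hbd ?_ ((ae_restrict_iff' measurableSet_Ioi).mpr (.of_forall hnorm))
    refine Measurable.aestronglyMeasurable ?_
    have : Measurable fun t : ℝ => (⌊t⌋₊ : ℂ) :=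
      (measurable_from_top (f := fun n : ℕ => (n : ℂ))).comp Nat.measurable_floor
    fun_prop
  have hsplit : riemannZeta s = s * (∫ t in Ioi (1 : ℝ),
      ((⌊t⌋₊ : ℂ) - t) * (t : ℂ) ^ (-(s + 1))) + s / (s - 1) := by
    have h3 : ∫ t in Ioi (1 : ℝ), (t : ℂ) ^ (-s) = 1 / (s - 1) := by
      rw [integral_Ioi_cpow_of_lt (by simpa using hs) zero_lt_one]
      have : -s + 1 ≠ 0 := by
        intro h; apply hs1; linear_combination -h
      simp only [Complex.ofReal_one, Complex.one_cpow]
      field_simp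
      ring
    rw [hz, div_eq_mul_one_div s, ← h3, ← mul_add, ← integral_add hi2 hi1]
    congr 1
    refine setIntegral_congr_fun measurableSet_Ioi fun t ht => ?_
    have ht0 : (t : ℂ) ≠ 0 := by
      have : (0 : ℝ) < t := lt_trans zero_lt_one ht
      exact_mod_cast this.ne'
    have : (t : ℂ) ^ (-s) = t * (t : ℂ) ^ (-(s + 1)) := by
      rw [show -s = 1 + -(s + 1) by ring, Complex.cpow_add _ _ ht0, Complex.cpow_one]
    rw [this]; ring
  have hint : ‖∫ t in Ioi (1 : ℝ), ((⌊t⌋₊ : ℂ) - t) * (t : ℂ) ^ (-(s + 1))‖ ≤ 1 := by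
    refine (norm_integral_le_of_norm_le hbd
      ((ae_restrict_iff' measurableSet_Ioi).mpr (.of_forall hnorm))).trans ?_
    rw [integral_Ioi_rpow_of_lt (by linarith) zero_lt_one]
    rw [Real.one_rpow, show -(s.re + 1) + 1 = -s.re by ring, neg_div_neg_eq, div_le_one hs0]
    exact hs.le
  rw [hsplit]
  refine (norm_add_le _ _).trans ?_
  rw [norm_mul, norm_div]
  gcongr
  exact mul_le_of_le_one_right (norm_nonneg _) hint

lemma norm_riemannZeta_le_of_one_le_re {s : ℂ} (hs : 1 ≤ s.re) (hs1 : s ≠ 1) :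
    ‖riemannZeta s‖ ≤ ‖s‖ + ‖s‖ / ‖s - 1‖ := by
  have hto : Tendsto (fun ε : ℝ => s + ε) (𝓝[>] 0) (𝓝 s) := by
    have : Continuous fun ε : ℝ => s + (ε : ℂ) := by fun_prop
    simpa using (this.tendsto 0).mono_left nhdsWithin_le_nhds
  have h1 := ((differentiableAt_riemannZeta hs1).continuousAt.norm.tendsto).comp hto
  have h2 : ContinuousAt (fun z : ℂ => ‖z‖ + ‖z‖ / ‖z - 1‖) s := by
    have : ‖s - 1‖ ≠ 0 := by simpa [sub_eq_zero] using hs1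
    fun_prop (disch := assumption)
  refine le_of_tendsto_of_tendsto h1 (h2.tendsto.comp hto) ?_
  filter_upwards [self_mem_nhdsWithin] with ε hε
  have : (0 : ℝ) < ε := hε
  refine norm_riemannZeta_le_of_one_lt_re ?_
  simp; linarith

/-- On the imaginary axis the functional equation expresses `Γ ζ` through `ζ` on `re s = 1`. -/
lemma norm_Gamma_mul_riemannZeta_I_mul {y : ℝ} (hy : y ≠ 0) :
    ‖Complex.Gamma (y * Complex.I) * riemannZeta (y * Complex.I)‖ =
      ‖riemannZeta (1 - y * Complex.I)‖ / (2 * Real.cosh (Real.pi * y / 2)) := by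
  have hre : (y * Complex.I).re = 0 := by simp
  have him : (y * Complex.I).im = y := by simp
  have hfe := riemannZeta_one_sub (s := y * Complex.I)
    (fun n h => by
      have := congrArg Complex.im h
      simp at this; exact hy this)
    (fun h => by
      have := congrArg Complex.im h
      simp at this; exact hy this)
  have hpi : ‖(2 * (Real.pi : ℂ)) ^ (-(y * Complex.I))‖ = 1 := by
    have : (2 * (Real.pi : ℂ)) = ((2 * Real.pi : ℝ) : ℂ) := by push_cast; ring
    rw [this, Complex.norm_cpow_eq_rpow_re_of_pos (by positivity)]
    simp
  have hcos : ‖Complex.cos (Real.pi * (y * Complex.I) / 2)‖ = Real.cosh (Real.pi * y / 2) := by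
    rw [show (Real.pi * (y * Complex.I) / 2 : ℂ) = ((Real.pi * y / 2 : ℝ) : ℂ) * Complex.I by
      push_cast; ring, Complex.cos_mul_I, ← Complex.ofReal_cosh, Complex.norm_real,
      Real.norm_eq_abs, abs_of_pos (Real.cosh_pos _)]
  have hc := Real.cosh_pos (Real.pi * y / 2)
  rw [hfe]
  simp only [norm_mul, hpi, hcos, Complex.norm_ofNat]
  field_simp

lemma norm_Gamma_mul_riemannZeta_I_mul_le {y : ℝ} (hy : 0 < y) :
    ‖Complex.Gamma (y * Complex.I) * riemannZeta (y * Complex.I)‖ ≤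
      (1 + y) * (1 + 1 / y) * Real.exp (-(Real.pi / 2 * y)) := by
  rw [norm_Gamma_mul_riemannZeta_I_mul hy.ne', div_le_iff₀ (by positivity)]
  have hz := norm_riemannZeta_le_of_one_le_re (s := 1 - y * Complex.I) (by simp) (by
    intro h
    have := congrArg Complex.im h
    simp at this; exact hy.ne' this)
  have h1 : ‖(1 - y * Complex.I : ℂ)‖ ≤ 1 + y := by
    refine (norm_sub_le _ _).trans ?_
    simp [abs_of_pos hy]
  have h2 : ‖(1 - y * Complex.I - 1 : ℂ)‖ = y := by simp [abs_of_pos hy]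
  rw [h2] at hz
  have h3 : Real.exp (Real.pi / 2 * y) ≤ 2 * Real.cosh (Real.pi * y / 2) := by
    rw [Real.cosh_eq, show Real.pi * y / 2 = Real.pi / 2 * y by ring]
    linarith [Real.exp_pos (-(Real.pi / 2 * y))]
  have h4 : 1 ≤ Real.exp (-(Real.pi / 2 * y)) * (2 * Real.cosh (Real.pi * y / 2)) := by
    calc (1 : ℝ) = Real.exp (-(Real.pi / 2 * y)) * Real.exp (Real.pi / 2 * y) := by
          rw [← Real.exp_add]; simp
      _ ≤ _ := by gcongr
  calc _ ≤ _ := hz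
    _ ≤ (1 + y) + (1 + y) / y := by gcongr
    _ = (1 + y) * (1 + 1 / y) := by ring
    _ ≤ (1 + y) * (1 + 1 / y) * (Real.exp (-(Real.pi / 2 * y)) *
        (2 * Real.cosh (Real.pi * y / 2))) := le_mul_of_one_le_right (by positivity) h4
    _ = _ := by ring

lemma gammaZetaTerm_eq (a : ℝ) (k : ℕ) :
    gammaZetaTerm a k = Complex.Gamma ((2 * Real.pi * k / Real.log a : ℝ) * Complex.I) *
      riemannZeta ((2 * Real.pi * k / Real.log a : ℝ) * Complex.I) := by
  have : (2 * (Real.pi : ℂ) * Complex.I * (k : ℂ) / (Real.log a : ℂ)) =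
      ((2 * Real.pi * k / Real.log a : ℝ) : ℂ) * Complex.I := by push_cast; ring
  rw [gammaZetaTerm, this]

lemma summable_gammaZetaTerm {a : ℝ} (ha : 1 < a) :
    Summable fun k : ℕ => gammaZetaTerm a (k + 1) := by
  have hL := Real.log_pos ha
  obtain ⟨c, hc⟩ : ∃ c, c = 2 * Real.pi / Real.log a := ⟨_, rfl⟩
  have hc0 : 0 < c := by rw [hc]; positivity
  have hq : 0 < Real.pi / 2 * c := by positivity
  have hs : Summable fun k : ℕ => ((k : ℝ) ^ 1 * Real.exp (-(Real.pi / 2 * c) * k)) :=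
    Real.summable_pow_mul_exp_neg_nat_mul 1 hq
  have hs' := ((summable_nat_add_iff 1).mpr hs).mul_left ((1 + c) * (1 + 1 / c))
  refine Summable.of_norm_bounded hs' fun k => ?_
  have hy : 2 * Real.pi * ((k + 1 : ℕ) : ℝ) / Real.log a = c * (k + 1) := by
    rw [hc]; push_cast; ring
  rw [gammaZetaTerm_eq, hy]
  refine (norm_Gamma_mul_riemannZeta_I_mul_le (by positivity)).trans ?_
  have hk : (1 : ℝ) ≤ k + 1 := by simp
  have e1 : 1 + c * (k + 1) ≤ (1 + c) * (k + 1) := by nlinarith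
  have e2 : 1 / (c * (k + 1)) ≤ 1 / c := by
    apply one_div_le_one_div_of_le hc0; nlinarith
  calc _ ≤ ((1 + c) * (k + 1)) * (1 + 1 / c) * Real.exp (-(Real.pi / 2 * (c * (k + 1)))) := by
        gcongr
    _ = _ := by push_cast; ring_nf

/-! ### Continuation of the Mellin transform to `-1 < re s`. -/

/-- `1 / (eˣ - 1)` with the singular part `1 / x - 1 / 2` of its expansion at `0` removed
on `(0, 1]`. -/
noncomputable def truncPlanck (x : ℝ) : ℂ :=
  planck x - indicator (Ioc 0 1) (fun t : ℝ => (t : ℂ) ^ (-1 : ℂ)) x +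
    (1 / 2 : ℂ) • indicator (Ioc 0 1) (fun _ : ℝ => (1 : ℂ)) x

lemma truncPlanck_of_le_one {x : ℝ} (hx : 0 < x) (hx1 : x ≤ 1) :
    truncPlanck x = ((planck x - x⁻¹ + 1 / 2 : ℝ) : ℂ) := by
  have : x ∈ Ioc (0 : ℝ) 1 := ⟨hx, hx1⟩
  simp [truncPlanck, this, Complex.cpow_neg_one]

lemma truncPlanck_of_one_lt {x : ℝ} (hx : 1 < x) : truncPlanck x = planck x := by
  have : x ∉ Ioc (0 : ℝ) 1 := fun h => absurd h.2 (not_le.mpr hx)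
  simp [truncPlanck, this]

lemma locallyIntegrableOn_indicator_Ioc {g : ℝ → ℂ} (hg : ContinuousOn g (Ioi 0)) :
    LocallyIntegrableOn (indicator (Ioc 0 1) g) (Ioi 0) := by
  have h := hg.locallyIntegrableOn (μ := volume) measurableSet_Ioi
  intro x hx
  obtain ⟨t, ht, hti⟩ := h x hx
  exact ⟨t, ht, hti.indicator measurableSet_Ioc⟩

lemma locallyIntegrableOn_truncPlanck : LocallyIntegrableOn truncPlanck (Ioi 0) := by
  have h1 : LocallyIntegrableOn (fun x : ℝ => (planck x : ℂ)) (Ioi 0) :=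
    (Complex.continuous_ofReal.comp_continuousOn continuousOn_planck).locallyIntegrableOn
      measurableSet_Ioi
  have h2 := locallyIntegrableOn_indicator_Ioc (g := fun t : ℝ => (t : ℂ) ^ (-1 : ℂ)) (by
    intro t ht
    exact (Complex.continuousAt_ofReal_cpow_const t (-1)
      (Or.inr (ne_of_gt ht))).continuousWithinAt)
  have h3 := locallyIntegrableOn_indicator_Ioc (g := fun _ : ℝ => (1 : ℂ)) continuousOn_const
  exact (h1.sub h2).add (h3.smul (1 / 2 : ℂ))

lemma truncPlanck_isBigO_atTop :
    truncPlanck =O[atTop] fun t : ℝ => Real.exp (-1 * t) := by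
  refine Asymptotics.IsBigO.of_bound 2 ?_
  filter_upwards [eventually_gt_atTop 1] with x hx
  rw [truncPlanck_of_one_lt hx, Complex.norm_real, Real.norm_eq_abs, Real.norm_eq_abs,
    abs_of_nonneg (planck_nonneg (by linarith)), abs_of_pos (Real.exp_pos _)]
  have h := Real.add_one_lt_exp (x := x) (by linarith)
  have h1 : 0 < Real.exp x - 1 := by linarith
  rw [planck, neg_one_mul, Real.exp_neg, div_le_iff₀ h1]
  have h2 := Real.exp_pos x
  field_simp
  linarith

lemma truncPlanck_isBigO_zero :
    truncPlanck =O[𝓝[>] 0] fun t : ℝ => t ^ (-(-1) : ℝ) := by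
  refine Asymptotics.IsBigO.of_bound 1 ?_
  filter_upwards [Ioc_mem_nhdsGT (zero_lt_one' ℝ)] with x hx
  rw [truncPlanck_of_le_one hx.1 hx.2, Complex.norm_real, Real.norm_eq_abs, neg_neg,
    Real.rpow_one, Real.norm_eq_abs, abs_of_pos hx.1, one_mul]
  exact abs_planck_sub_inv_add_half_le hx.1 hx.2

lemma mellinConvergent_truncPlanck {s : ℂ} (hs : -1 < s.re) : MellinConvergent truncPlanck s :=
  mellinConvergent_of_isBigO_rpow_exp one_pos locallyIntegrableOn_truncPlanck
    truncPlanck_isBigO_atTop truncPlanck_isBigO_zero hs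

lemma differentiableAt_mellin_truncPlanck {s : ℂ} (hs : -1 < s.re) :
    DifferentiableAt ℂ (mellin truncPlanck) s :=
  mellin_differentiableAt_of_isBigO_rpow_exp one_pos locallyIntegrableOn_truncPlanck
    truncPlanck_isBigO_atTop truncPlanck_isBigO_zero hs

lemma mellin_truncPlanck_of_one_lt_re {s : ℂ} (hs : 1 < s.re) :
    mellin truncPlanck s =
      Complex.Gamma s * riemannZeta s - 1 / (s - 1) + 1 / 2 * (1 / s) := by
  have h1 := hasMellin_cpow_Ioc (-1) (s := s) (by simp; linarith)
  have h2 := hasMellin_one_Ioc (s := s) (by linarith)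
  have h2' := hasMellin_const_smul h2.1 (1 / 2 : ℂ)
  have h12 := hasMellin_sub h2'.1 h1.1
  -- Convergence for `planck` follows by restoring the removed pieces to `truncPlanck`.
  have h0 : MellinConvergent (fun x => (planck x : ℂ)) s := by
    convert (hasMellin_sub (mellinConvergent_truncPlanck (s := s) (by linarith)) h12.1).1 using 2
    simp only [truncPlanck]; ring
  have h3 := hasMellin_add (hasMellin_sub h0 h1.1).1 h2'.1
  have h4 : truncPlanck = fun x : ℝ => (planck x - indicator (Ioc 0 1)
    (fun t : ℝ => (t : ℂ) ^ (-1 : ℂ)) x +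
    (1 / 2 : ℂ) • indicator (Ioc 0 1) (fun _ : ℝ => (1 : ℂ)) x : ℂ) := rfl
  rw [h4, h3.2, (hasMellin_sub h0 h1.1).2, h2'.2, h1.2, h2.2, mellin_planck hs, smul_eq_mul,
    ← sub_eq_add_neg]

/-- The factor `s * (s - 1)` clears the poles at `0` and `1`, so both sides are holomorphic on the
half-plane and the identity theorem extends the equality from `1 < re s`. In this form it remains
usable at `s = 0`. -/
lemma mul_mellin_truncPlanck {s : ℂ} (hs : -1 < s.re) :
    s * (s - 1) * mellin truncPlanck s =
      Complex.Gamma (s + 1) * riemannZeta₁ s - s + (s - 1) / 2 := by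
  have hopen : IsOpen {z : ℂ | -1 < z.re} := isOpen_lt continuous_const Complex.continuous_re
  have hconv : Convex ℝ {z : ℂ | -1 < z.re} := convex_halfSpace_re_gt (-1)
  have hf : AnalyticOnNhd ℂ (fun z => z * (z - 1) * mellin truncPlanck z) {z : ℂ | -1 < z.re} := by
    refine DifferentiableOn.analyticOnNhd (fun z hz => ?_) hopen
    have := differentiableAt_mellin_truncPlanck hz
    exact (by fun_prop : DifferentiableAt ℂ
      (fun z => z * (z - 1) * mellin truncPlanck z) z).differentiableWithinAt
  have hg : AnalyticOnNhd ℂ (fun z => Complex.Gamma (z + 1) * riemannZeta₁ z - z + (z - 1) / 2)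
      {z : ℂ | -1 < z.re} := by
    refine DifferentiableOn.analyticOnNhd (fun z hz => ?_) hopen
    have h1 := differentiable_riemannZeta₁ z
    have h2 : DifferentiableAt ℂ (fun z => Complex.Gamma (z + 1)) z := by
      refine DifferentiableAt.comp z (Complex.differentiableAt_Gamma _ fun m h => ?_) (by fun_prop)
      have h' := congrArg Complex.re h
      have hz' : -1 < z.re := hz
      simp at h'
      have : (0 : ℝ) ≤ m := by positivity
      linarith
    exact (by fun_prop : DifferentiableAt ℂ
      (fun z => Complex.Gamma (z + 1) * riemannZeta₁ z - z + (z - 1) / 2) z).differentiableWithinAt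
  refine hf.eqOn_of_preconnected_of_eventuallyEq hg hconv.isPreconnected
    (z₀ := 2) (by simp; norm_num) ?_ hs
  have hU : {z : ℂ | 1 < z.re} ∈ 𝓝 (2 : ℂ) :=
    (isOpen_lt continuous_const Complex.continuous_re).mem_nhds (by simp)
  filter_upwards [hU] with z hz
  have hz' : 1 < z.re := hz
  have hz0 : z ≠ 0 := by rintro rfl; simp at hz'; linarith
  have hz1 : z ≠ 1 := by rintro rfl; simp at hz'
  have hz1' : z - 1 ≠ 0 := sub_ne_zero.mpr hz1
  rw [mellin_truncPlanck_of_one_lt_re hz, Complex.Gamma_add_one z hz0,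
    riemannZeta_eq_inv_sub_mul hz1]
  field_simp

lemma mellin_truncPlanck {s : ℂ} (hs : -1 < s.re) (hs0 : s ≠ 0) (hs1 : s ≠ 1) :
    mellin truncPlanck s =
      Complex.Gamma s * riemannZeta s - 1 / (s - 1) + 1 / 2 * (1 / s) := by
  have h := mul_mellin_truncPlanck hs
  have hs1' : s - 1 ≠ 0 := sub_ne_zero.mpr hs1
  rw [Complex.Gamma_add_one s hs0] at h
  refine mul_left_cancel₀ (mul_ne_zero hs0 hs1') ?_
  rw [h, riemannZeta_eq_inv_sub_mul hs1]
  field_simp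

/-- The value at `0` is the derivative there of `s * mellin truncPlanck s`, computed from `Γ'(1) =
-γ`, `ζ(0) = -1/2` and `ζ'(0) = -log (2π) / 2`. -/
lemma mellin_truncPlanck_zero :
    mellin truncPlanck 0 =
      ((1 + (Real.eulerMascheroniConstant - Real.log (2 * Real.pi)) / 2 : ℝ) : ℂ) := by
  have hG : HasDerivAt (fun s : ℂ => Complex.Gamma (s + 1))
      (-(Real.eulerMascheroniConstant : ℂ)) 0 := by
    have := Complex.hasDerivAt_Gamma_one
    rw [← zero_add (1 : ℂ)] at this
    exact this.comp_add_const 0 1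
  have hZ : HasDerivAt riemannZeta (-Complex.log (2 * Real.pi) / 2) 0 := by
    rw [← deriv_riemannZeta_zero]
    exact (differentiableAt_riemannZeta zero_ne_one).hasDerivAt
  have hd := hG.mul hZ
  have hm := (differentiableAt_mellin_truncPlanck (s := 0) (by simp)).hasDerivAt
  have hl := (hasDerivAt_id (0 : ℂ)).mul hm
  have hr : HasDerivAt (fun s : ℂ => Complex.Gamma (s + 1) * riemannZeta s - s / (s - 1) + 1 / 2)
      (-(Real.eulerMascheroniConstant : ℂ) * riemannZeta 0 +
        Complex.Gamma (0 + 1) * (-Complex.log (2 * Real.pi) / 2) + 1) 0 := by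
    have h1 : HasDerivAt (fun s : ℂ => s / (s - 1)) (-1) 0 := by
      have := (hasDerivAt_id (0 : ℂ)).div ((hasDerivAt_id (0 : ℂ)).sub_const 1) (by simp)
      simpa using! this
    have := (hd.sub h1).add_const (1 / 2)
    simpa [sub_eq_add_neg] using! this
  have heq : (fun s => id s * mellin truncPlanck s) =ᶠ[𝓝 0]
      fun s : ℂ => Complex.Gamma (s + 1) * riemannZeta s - s / (s - 1) + 1 / 2 := by
    have hU : {z : ℂ | -1 < z.re} ∈ 𝓝 (0 : ℂ) :=
      (isOpen_lt continuous_const Complex.continuous_re).mem_nhds (by simp)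
    filter_upwards [hU, isOpen_ne.mem_nhds (zero_ne_one' ℂ)] with s hs hs1
    have hs1' : s - 1 ≠ 0 := sub_ne_zero.mpr hs1
    refine mul_left_cancel₀ hs1' ?_
    have h := mul_mellin_truncPlanck hs
    rw [riemannZeta_eq_inv_sub_mul hs1]
    simp only [id]
    rw [show (s - 1) * (s * mellin truncPlanck s) = s * (s - 1) * mellin truncPlanck s by ring, h]
    field_simp
  have huniq := (hl.congr_of_eventuallyEq heq.symm).unique hr
  rw [riemannZeta_zero] at huniq
  simp only [id, one_mul, zero_mul, add_zero, zero_add, Complex.Gamma_one] at huniq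
  rw [huniq]
  push_cast
  rw [Complex.ofReal_log (by positivity)]
  push_cast
  ring

/-! ### The ramp cutoff and the Mellin transform of the regularization. -/

/-- The continuous cutoff in the variable `log x`: it is `1` for `x ≤ e⁻ᴸ` and `0` for `1 ≤ x`. -/
noncomputable def logCutoff (L x : ℝ) : ℝ := max 0 (min 1 (-Real.log x / L))

lemma logCutoff_of_le {L x : ℝ} (hL : 0 < L) (hx : 0 < x) (h : x ≤ Real.exp (-L)) :
    logCutoff L x = 1 := by
  have : 1 ≤ -Real.log x / L := by
    rw [one_le_div hL]
    have := (Real.log_le_iff_le_exp hx).mpr h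
    linarith
  simp [logCutoff, min_eq_left this]

lemma logCutoff_of_one_le {L x : ℝ} (hL : 0 < L) (h : 1 ≤ x) : logCutoff L x = 0 := by
  have h0 : -Real.log x / L ≤ 0 :=
    div_nonpos_of_nonpos_of_nonneg (by linarith [Real.log_nonneg h]) hL.le
  exact max_eq_left ((min_le_right _ _).trans h0)

lemma logCutoff_of_mem {L x : ℝ} (hL : 0 < L) (h : Real.exp (-L) < x) (h1 : x ≤ 1) :
    logCutoff L x = -Real.log x / L := by
  have hx : 0 < x := (Real.exp_pos _).trans h
  have h0 : 0 ≤ -Real.log x / L := by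
    have := Real.log_nonpos hx.le h1
    exact div_nonneg (by linarith) hL.le
  have h2 : -Real.log x / L ≤ 1 := by
    rw [div_le_one hL]
    have := (Real.lt_log_iff_exp_lt hx).mpr h
    linarith
  rw [logCutoff, min_eq_right h2, max_eq_right h0]

/-- A regularization of `1 / (eˣ - 1)` that vanishes at both `0` and `∞`. -/
noncomputable def regPlanck (L x : ℝ) : ℝ := planck x - x⁻¹ + logCutoff L x / 2

lemma regPlanck_eq_truncPlanck_add {L x : ℝ} (hL : 0 < L) (hx : 0 < x) :
    (regPlanck L x : ℂ) = truncPlanck x - indicator (Ioi 1) (fun t : ℝ => (t : ℂ) ^ (-1 : ℂ)) x +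
      (1 / 2 : ℂ) • indicator (Ioc (Real.exp (-L)) 1)
        (fun t : ℝ => ((-Real.log t / L - 1 : ℝ) : ℂ)) x := by
  rcases lt_or_ge 1 x with h1 | h1
  · have e1 : x ∈ Ioi (1 : ℝ) := h1
    have e2 : x ∉ Ioc (Real.exp (-L)) 1 := fun h => absurd h.2 (not_le.mpr h1)
    rw [truncPlanck_of_one_lt h1, indicator_of_mem e1, indicator_of_notMem e2, regPlanck,
      logCutoff_of_one_le hL h1.le]
    simp [Complex.cpow_neg_one]
  · have e1 : x ∉ Ioi (1 : ℝ) := not_lt.mpr h1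
    rw [truncPlanck_of_le_one hx h1, indicator_of_notMem e1, regPlanck]
    rcases le_or_gt x (Real.exp (-L)) with h2 | h2
    · have e2 : x ∉ Ioc (Real.exp (-L)) 1 := fun h => absurd h.1 (not_lt.mpr h2)
      rw [indicator_of_notMem e2, logCutoff_of_le hL hx h2]
      simp
    · have e2 : x ∈ Ioc (Real.exp (-L)) 1 := ⟨h2, h1⟩
      rw [indicator_of_mem e2, logCutoff_of_mem hL h2 h1]
      push_cast
      simp only [smul_eq_mul]
      ring

/-- Removing `1 / x` on `x > 1` as well contributes `1 / (s - 1)`, which cancels the term `-1 / (s -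
1)` in `mellin_truncPlanck`. -/
lemma hasMellin_indicator_Ioi_cpow_neg_one {s : ℂ} (hs : s.re < 1) :
    HasMellin (indicator (Ioi 1) (fun t : ℝ => (t : ℂ) ^ (-1 : ℂ))) s (-(1 / (s - 1))) := by
  have hs' : (s - 2).re < -1 := by simp; linarith
  have hsub : Ioi (1 : ℝ) ∩ Ioi 0 = Ioi 1 := by
    rw [Ioi_inter_Ioi]; simp
  have key : EqOn (fun t : ℝ => (t : ℂ) ^ (s - 1) • (t : ℂ) ^ (-1 : ℂ))
      (fun t : ℝ => (t : ℂ) ^ (s - 2)) (Ioi 1) := by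
    intro t ht
    have ht0 : (t : ℂ) ≠ 0 := by
      have : (0 : ℝ) < t := lt_trans zero_lt_one ht
      exact_mod_cast this.ne'
    simp only [smul_eq_mul]
    rw [← Complex.cpow_add _ _ ht0]
    ring_nf
  have hind : (fun t : ℝ => (t : ℂ) ^ (s - 1) •
      indicator (Ioi 1) (fun t : ℝ => (t : ℂ) ^ (-1 : ℂ)) t) =
      indicator (Ioi 1) (fun t : ℝ => (t : ℂ) ^ (s - 1) • (t : ℂ) ^ (-1 : ℂ)) := by
    ext t
    by_cases h : t ∈ Ioi (1 : ℝ) <;> simp [h]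
  constructor
  · rw [MellinConvergent, hind, IntegrableOn, integrable_indicator_iff measurableSet_Ioi,
      IntegrableOn, Measure.restrict_restrict measurableSet_Ioi, hsub]
    exact (integrableOn_congr_fun key measurableSet_Ioi).mpr
      (integrableOn_Ioi_cpow_of_lt hs' zero_lt_one)
  · rw [mellin, hind, setIntegral_indicator measurableSet_Ioi, inter_comm, hsub,
      setIntegral_congr_fun measurableSet_Ioi key, integral_Ioi_cpow_of_lt hs' zero_lt_one]
    simp only [Complex.ofReal_one, Complex.one_cpow]
    rw [show s - 2 + 1 = s - 1 by ring]
    ring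

lemma hasMellin_indicator_Ioc {c : ℝ} (hc : 0 < c) (hc1 : c ≤ 1) {g : ℝ → ℂ}
    (hg : ContinuousOn g (Icc c 1)) (s : ℂ) :
    HasMellin (indicator (Ioc c 1) g) s (∫ t in c..1, (t : ℂ) ^ (s - 1) * g t) := by
  have hsub : Ioc c 1 ∩ Ioi 0 = Ioc c 1 :=
    inter_eq_left.mpr fun x hx => hc.trans hx.1
  have hind : (fun t : ℝ => (t : ℂ) ^ (s - 1) • indicator (Ioc c 1) g t) =
      indicator (Ioc c 1) (fun t : ℝ => (t : ℂ) ^ (s - 1) * g t) := by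
    ext t
    by_cases h : t ∈ Ioc c 1 <;> simp [h]
  have hcont : ContinuousOn (fun t : ℝ => (t : ℂ) ^ (s - 1) * g t) (Icc c 1) := by
    refine ContinuousOn.mul (fun t ht => ?_) hg
    exact (Complex.continuousAt_ofReal_cpow_const t _
      (Or.inr (hc.trans_le ht.1).ne')).continuousWithinAt
  constructor
  · rw [MellinConvergent, hind, IntegrableOn, integrable_indicator_iff measurableSet_Ioc,
      IntegrableOn, Measure.restrict_restrict measurableSet_Ioc, hsub]
    exact (hcont.integrableOn_Icc).mono_set Ioc_subset_Icc_self
  · rw [mellin, hind, setIntegral_indicator measurableSet_Ioc, inter_comm, hsub,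
      intervalIntegral.integral_of_le hc1]

lemma continuousOn_neg_log_div_sub_one (L : ℝ) :
    ContinuousOn (fun t : ℝ => ((-Real.log t / L - 1 : ℝ) : ℂ)) (Ioi 0) := by
  refine Complex.continuous_ofReal.comp_continuousOn ?_
  have : ContinuousOn Real.log (Ioi 0) := Real.continuousOn_log.mono fun x hx => ne_of_gt hx
  fun_prop

lemma mellin_regPlanck {L : ℝ} (hL : 0 < L) {s : ℂ} (hs : -1 < s.re) (hs1 : s.re < 1) :
    mellin (fun x => (regPlanck L x : ℂ)) s = mellin truncPlanck s + 1 / (s - 1) +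
      1 / 2 * ∫ t in Real.exp (-L)..1, (t : ℂ) ^ (s - 1) * ((-Real.log t / L - 1 : ℝ) : ℂ) := by
  have h1 := hasMellin_indicator_Ioi_cpow_neg_one hs1
  have h2 := hasMellin_indicator_Ioc (c := Real.exp (-L)) (Real.exp_pos _) (by simpa using hL.le)
    ((continuousOn_neg_log_div_sub_one L).mono fun x hx => (Real.exp_pos _).trans_le hx.1) s
  have h2' := hasMellin_const_smul h2.1 (1 / 2 : ℂ)
  have h3 := hasMellin_sub (mellinConvergent_truncPlanck hs) h1.1
  have h4 := hasMellin_add h3.1 h2'.1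
  rw [h3.2, h2'.2, h1.2, h2.2, smul_eq_mul, sub_neg_eq_add] at h4
  rw [← h4.2]
  refine setIntegral_congr_fun measurableSet_Ioi fun t ht => ?_
  simp only
  rw [regPlanck_eq_truncPlanck_add hL ht]

lemma integral_cutoff_zero {L : ℝ} (hL : 0 < L) :
    ∫ t in Real.exp (-L)..1, (t : ℂ) ^ ((0 : ℂ) - 1) * ((-Real.log t / L - 1 : ℝ) : ℂ) =
      ((-L / 2 : ℝ) : ℂ) := by
  have hle : Real.exp (-L) ≤ 1 := by simpa using hL.le
  have hpos : ∀ t ∈ uIcc (Real.exp (-L)) 1, 0 < t := fun t ht => by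
    rw [uIcc_of_le hle] at ht; exact (Real.exp_pos _).trans_le ht.1
  have hreal : ∀ t ∈ uIcc (Real.exp (-L)) 1,
      (t : ℂ) ^ ((0 : ℂ) - 1) * ((-Real.log t / L - 1 : ℝ) : ℂ) =
      ((t⁻¹ * (-Real.log t / L - 1) : ℝ) : ℂ) := fun t _ => by
    rw [zero_sub, Complex.cpow_neg_one]; push_cast; ring
  rw [intervalIntegral.integral_congr hreal, intervalIntegral.integral_ofReal]
  congr 1
  have hd : ∀ t ∈ uIcc (Real.exp (-L)) 1, HasDerivAt
      (fun t => -(Real.log t) ^ 2 / (2 * L) - Real.log t) (t⁻¹ * (-Real.log t / L - 1)) t := by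
    intro t ht
    have h := Real.hasDerivAt_log (hpos t ht).ne'
    convert! (((h.pow 2).neg.div_const (2 * L)).sub h) using 1
    field_simp
    ring
  rw [intervalIntegral.integral_eq_sub_of_hasDerivAt hd]
  · simp only [Real.log_one, Real.log_exp]
    field_simp
    ring
  · refine ContinuousOn.intervalIntegrable ?_
    have h1 : ContinuousOn Real.log (uIcc (Real.exp (-L)) 1) :=
      Real.continuousOn_log.mono fun x hx => (hpos x hx).ne'
    have h2 : ∀ t ∈ uIcc (Real.exp (-L)) 1, t ≠ 0 := fun t ht => (hpos t ht).ne'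
    fun_prop (disch := assumption)

/-- Integration by parts: the ramp factor vanishes at `e^(-L)`, and the remaining terms in `t^s /
(s² L)` agree at both endpoints because `e^(-Ls) = 1`. The result cancels the `1 / s` of
`mellin_truncPlanck`. -/
lemma integral_cutoff {L : ℝ} (hL : 0 < L) {s : ℂ} (hs : s ≠ 0)
    (hper : Complex.exp (-L * s) = 1) :
    ∫ t in Real.exp (-L)..1, (t : ℂ) ^ (s - 1) * ((-Real.log t / L - 1 : ℝ) : ℂ) = -(1 / s) := by
  have hle : Real.exp (-L) ≤ 1 := by simpa using hL.le
  have hpos : ∀ t ∈ uIcc (Real.exp (-L)) 1, 0 < t := fun t ht => by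
    rw [uIcc_of_le hle] at ht; exact (Real.exp_pos _).trans_le ht.1
  have hLc : (L : ℂ) ≠ 0 := by exact_mod_cast hL.ne'
  have hd : ∀ t ∈ uIcc (Real.exp (-L)) 1, HasDerivAt
      (fun t : ℝ => ((t : ℂ) ^ s / s) * ((-Real.log t / L - 1 : ℝ) : ℂ) + (t : ℂ) ^ s / s / (s * L))
      ((t : ℂ) ^ (s - 1) * ((-Real.log t / L - 1 : ℝ) : ℂ)) t := by
    intro t ht
    have htp := hpos t ht
    have ht0 : (t : ℂ) ≠ 0 := by exact_mod_cast htp.ne'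
    have h1 : HasDerivAt (fun t : ℝ => (t : ℂ) ^ s / s) ((t : ℂ) ^ (s - 1)) t := by
      have := hasDerivAt_ofReal_cpow_const' htp.ne' (r := s - 1) (by
        intro h; apply hs; linear_combination h)
      simpa using this
    have h2 : HasDerivAt (fun t : ℝ => ((-Real.log t / L - 1 : ℝ) : ℂ))
        ((-t⁻¹ / L : ℝ) : ℂ) t :=
      (((Real.hasDerivAt_log htp.ne').neg.div_const L).sub_const 1).ofReal_comp
    convert! (h1.mul h2).add (h1.div_const (s * L)) using 1
    have hp : (t : ℂ) ^ s = (t : ℂ) ^ (s - 1) * t := by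
      rw [Complex.cpow_sub _ _ ht0, Complex.cpow_one]; field_simp
    rw [hp]
    push_cast
    field_simp
    ring
  rw [intervalIntegral.integral_eq_sub_of_hasDerivAt hd]
  · have he : ((Real.exp (-L) : ℝ) : ℂ) ^ s = 1 := by
      rw [Complex.cpow_def_of_ne_zero (by exact_mod_cast (Real.exp_pos _).ne'),
        ← Complex.ofReal_log (Real.exp_pos _).le, Real.log_exp, ← hper]
      push_cast; rfl
    rw [he]
    simp only [Real.log_one, Real.log_exp, Complex.ofReal_one, Complex.one_cpow]
    have : -(-L) / L - 1 = 0 := by field_simp; ring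
    rw [this]
    push_cast
    ring
  · refine ContinuousOn.intervalIntegrable ?_
    refine ContinuousOn.mul (fun t ht => ?_)
      ((continuousOn_neg_log_div_sub_one L).mono hpos)
    exact (Complex.continuousAt_ofReal_cpow_const t _
      (Or.inr (hpos t ht).ne')).continuousWithinAt

lemma mellin_regPlanck_zero {L : ℝ} (hL : 0 < L) :
    mellin (fun x => (regPlanck L x : ℂ)) 0 =
      (((Real.eulerMascheroniConstant - Real.log (2 * Real.pi)) / 2 - L / 4 : ℝ) : ℂ) := by
  rw [mellin_regPlanck hL (by simp) (by simp), integral_cutoff_zero hL, mellin_truncPlanck_zero]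
  push_cast
  ring

lemma mellin_regPlanck_of_exp_eq_one {L : ℝ} (hL : 0 < L) {s : ℂ} (hs : s ≠ 0) (hre : s.re = 0)
    (hper : Complex.exp (-L * s) = 1) :
    mellin (fun x => (regPlanck L x : ℂ)) s = Complex.Gamma s * riemannZeta s := by
  have hs1 : s ≠ 1 := by rintro rfl; simp at hre
  rw [mellin_regPlanck hL (by simp [hre]) (by simp [hre]), integral_cutoff hL hs hper,
    mellin_truncPlanck (by simp [hre]) hs hs1]
  ring

/-! ### Poisson summation. -/

lemma logCutoff_exp {L : ℝ} (hL : 0 < L) (u : ℝ) :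
    logCutoff L (Real.exp (-(L * u))) = max 0 (min 1 u) := by
  rw [logCutoff, Real.log_exp, neg_neg, mul_div_cancel_left₀ _ hL.ne']

lemma continuous_regPlanck_exp {L : ℝ} (hL : 0 < L) :
    Continuous fun u : ℝ => (regPlanck L (Real.exp (-(L * u))) : ℂ) := by
  have h1 : Continuous fun u : ℝ => planck (Real.exp (-(L * u))) :=
    continuousOn_planck.comp_continuous (by fun_prop) fun u => Real.exp_pos _
  have h2 : Continuous fun u : ℝ => (Real.exp (-(L * u)))⁻¹ :=
    Continuous.inv₀ (by fun_prop) fun u => (Real.exp_pos _).ne'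
  unfold regPlanck
  simp_rw [logCutoff_exp hL]
  fun_prop

lemma abs_regPlanck_of_le_exp {L x : ℝ} (hL : 0 < L) (hx : 0 < x) (h : x ≤ Real.exp (-L)) :
    |regPlanck L x| ≤ x := by
  rw [regPlanck, logCutoff_of_le hL hx h]
  exact abs_planck_sub_inv_add_half_le hx (h.trans (by simpa using hL.le))

lemma abs_regPlanck_of_one_le {L x : ℝ} (hL : 0 < L) (h : 1 ≤ x) :
    |regPlanck L x| ≤ x⁻¹ := by
  have hx : 0 < x := by linarith
  have h1 := planck_nonneg hx
  have h2 := planck_le_inv hx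
  rw [regPlanck, logCutoff_of_one_le hL h, abs_le]
  constructor <;> linarith

lemma norm_regPlanck_exp_le {L u : ℝ} (hL : 0 < L) (hu : 1 ≤ |u|) :
    ‖(regPlanck L (Real.exp (-(L * u))) : ℂ)‖ ≤ Real.exp (-L * |u|) := by
  rw [Complex.norm_real, Real.norm_eq_abs]
  rcases le_abs.mp hu with h | h
  · rw [abs_of_nonneg (by linarith : 0 ≤ u), neg_mul]
    exact abs_regPlanck_of_le_exp hL (Real.exp_pos _) (Real.exp_le_exp.mpr (by nlinarith))
  · rw [abs_of_nonpos (by linarith : u ≤ 0)]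
    refine (abs_regPlanck_of_one_le hL (Real.one_le_exp (by nlinarith))).trans ?_
    rw [← Real.exp_neg]
    exact Real.exp_le_exp.mpr (by linarith)

lemma regPlanck_exp_isBigO {L : ℝ} (hL : 0 < L) :
    (fun u : ℝ => (regPlanck L (Real.exp (-(L * u))) : ℂ)) =O[cocompact ℝ]
      fun u : ℝ => |u| ^ (-2 : ℝ) := by
  have ht : Tendsto (fun u : ℝ => |u|) (cocompact ℝ) atTop := tendsto_norm_cocompact_atTop
  refine Asymptotics.IsBigO.trans (Asymptotics.IsBigO.of_bound 1 ?_)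
    ((isLittleO_exp_neg_mul_rpow_atTop hL (-2)).isBigO.comp_tendsto ht)
  filter_upwards [ht.eventually_ge_atTop 1] with u hu
  rw [one_mul]
  refine (norm_regPlanck_exp_le hL hu).trans ?_
  simp [abs_of_pos (Real.exp_pos _)]

/-- The Mellin transform is a Fourier transform in `v = -log x`; the dilation `v = L * u` produces
the factor `1 / L`. -/
lemma fourier_regPlanck_exp {L : ℝ} (hL : 0 < L) (ξ : ℝ) :
    𝓕 (fun u : ℝ => (regPlanck L (Real.exp (-(L * u))) : ℂ)) ξ =
      (1 / L : ℂ) * mellin (fun x => (regPlanck L x : ℂ))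
        ((2 * Real.pi * ξ / L : ℝ) * Complex.I) := by
  rw [mellin_eq_fourier, Real.fourier_real_eq_integral_exp_smul,
    Real.fourier_real_eq_integral_exp_smul]
  have h := Measure.integral_comp_mul_left (fun v : ℝ =>
    Complex.exp (((-2 * Real.pi * v * (ξ / L) : ℝ) : ℂ) * Complex.I) •
      (regPlanck L (Real.exp (-v)) : ℂ)) L
  rw [abs_of_pos (inv_pos.mpr hL)] at h
  have e1 : (((2 * Real.pi * ξ / L : ℝ) : ℂ) * Complex.I).re = 0 := by simp
  have e2 : (((2 * Real.pi * ξ / L : ℝ) : ℂ) * Complex.I).im / (2 * Real.pi) = ξ / L := by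
    have : (((2 * Real.pi * ξ / L : ℝ) : ℂ) * Complex.I).im = 2 * Real.pi * ξ / L := by simp
    rw [this]
    field_simp
  rw [e1, e2]
  simp only [neg_zero, zero_mul, Real.exp_zero, one_smul]
  have h' : (1 / L : ℂ) * ∫ v : ℝ, Complex.exp (((-2 * Real.pi * v * (ξ / L) : ℝ) : ℂ) *
      Complex.I) • (regPlanck L (Real.exp (-v)) : ℂ) = L⁻¹ • ∫ v : ℝ,
      Complex.exp (((-2 * Real.pi * v * (ξ / L) : ℝ) : ℂ) * Complex.I) •
      (regPlanck L (Real.exp (-v)) : ℂ) := by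
    rw [Complex.real_smul]; push_cast; ring
  rw [h', ← h]
  congr 1
  ext u
  congr 4
  field_simp

/-- The Fourier coefficients of the periodized regularization. -/
lemma mellin_regPlanck_nat {a : ℝ} (ha : 1 < a) (k : ℕ) :
    mellin (fun x => (regPlanck (Real.log a) x : ℂ))
      ((2 * Real.pi * ((k + 1 : ℤ) : ℝ) / Real.log a : ℝ) * Complex.I) =
        gammaZetaTerm a (k + 1) ∧
    mellin (fun x => (regPlanck (Real.log a) x : ℂ))
      ((2 * Real.pi * ((-(k + 1) : ℤ) : ℝ) / Real.log a : ℝ) * Complex.I) =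
        (starRingEnd ℂ) (gammaZetaTerm a (k + 1)) := by
  have hL := Real.log_pos ha
  have hLc : (Real.log a : ℂ) ≠ 0 := by exact_mod_cast hL.ne'
  have main : ∀ n : ℤ, n ≠ 0 → mellin (fun x => (regPlanck (Real.log a) x : ℂ))
      ((2 * Real.pi * (n : ℝ) / Real.log a : ℝ) * Complex.I) =
      Complex.Gamma ((2 * Real.pi * (n : ℝ) / Real.log a : ℝ) * Complex.I) *
        riemannZeta ((2 * Real.pi * (n : ℝ) / Real.log a : ℝ) * Complex.I) := by
    intro n hn
    refine mellin_regPlanck_of_exp_eq_one hL ?_ (by simp) ?_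
    · refine mul_ne_zero ?_ Complex.I_ne_zero
      have : (n : ℝ) ≠ 0 := by exact_mod_cast hn
      have := Real.pi_ne_zero
      exact_mod_cast (by positivity : 2 * Real.pi * (n : ℝ) / Real.log a ≠ 0)
    · rw [Complex.exp_eq_one_iff]
      refine ⟨-n, ?_⟩
      push_cast
      field_simp
  constructor
  · rw [main _ (by positivity), gammaZetaTerm_eq]
    push_cast; rfl
  · rw [main _ (by omega), gammaZetaTerm_eq, map_mul, ← Complex.Gamma_conj, ← riemannZeta_conj]
    have : (((2 * Real.pi * ((-(k + 1) : ℤ) : ℝ) / Real.log a : ℝ) : ℂ) * Complex.I) =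
        (starRingEnd ℂ) (((2 * Real.pi * ((k + 1 : ℕ) : ℝ) / Real.log a : ℝ) : ℂ) * Complex.I) := by
      rw [map_mul, Complex.conj_ofReal, Complex.conj_I]
      push_cast; ring
    rw [this]

lemma hasSum_fourier_regPlanck_exp {a : ℝ} (ha : 1 < a) :
    HasSum (fun n : ℤ => 𝓕 (fun u : ℝ => (regPlanck (Real.log a)
        (Real.exp (-(Real.log a * u))) : ℂ)) (n : ℝ))
      ((1 / Real.log a * (2 * (∑' k : ℕ, gammaZetaTerm a (k + 1)).re +
        ((Real.eulerMascheroniConstant - Real.log (2 * Real.pi)) / 2 - Real.log a / 4)) : ℝ)) := by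
  have hL := Real.log_pos ha
  have hs := (summable_gammaZetaTerm ha).hasSum
  have hsc := Complex.hasSum_conj'.mpr hs
  simp_rw [fourier_regPlanck_exp hL]
  have hz : HasSum (fun n : ℤ => mellin (fun x => (regPlanck (Real.log a) x : ℂ))
      ((2 * Real.pi * (n : ℝ) / Real.log a : ℝ) * Complex.I)) (∑' k : ℕ, gammaZetaTerm a (k + 1) +
      mellin (fun x => (regPlanck (Real.log a) x : ℂ))
        ((2 * Real.pi * ((0 : ℤ) : ℝ) / Real.log a : ℝ) * Complex.I) +
      (starRingEnd ℂ) (∑' k : ℕ, gammaZetaTerm a (k + 1))) := by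
    -- Coefficients at `n` and `-n` are conjugate, so the two halves add up to twice a real part.
    refine HasSum.of_add_one_of_neg_add_one (f := fun n : ℤ => mellin
      (fun x => (regPlanck (Real.log a) x : ℂ))
      ((2 * Real.pi * (n : ℝ) / Real.log a : ℝ) * Complex.I)) ?_ ?_
    · convert hs using 2 with k
      exact (mellin_regPlanck_nat ha k).1
    · convert hsc using 2 with k
      exact (mellin_regPlanck_nat ha k).2
  convert! hz.mul_left (1 / Real.log a : ℂ) using 1
  have h0 : (((2 * Real.pi * ((0 : ℤ) : ℝ) / Real.log a : ℝ) : ℂ) * Complex.I) = 0 := by simp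
  rw [h0, mellin_regPlanck_zero hL, add_right_comm, Complex.add_conj]
  push_cast
  ring

lemma tsum_regPlanck_exp {a : ℝ} (ha : 1 < a) :
    ∑' n : ℤ, regPlanck (Real.log a) (Real.exp (-(Real.log a * n))) =
      1 / Real.log a * (2 * (∑' k : ℕ, gammaZetaTerm a (k + 1)).re +
        ((Real.eulerMascheroniConstant - Real.log (2 * Real.pi)) / 2 - Real.log a / 4)) := by
  have hL := Real.log_pos ha
  have hF := hasSum_fourier_regPlanck_exp ha
  have hP := Real.tsum_eq_tsum_fourier_of_rpow_decay_of_summable (continuous_regPlanck_exp hL)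
    one_lt_two (regPlanck_exp_isBigO hL) hF.summable 0
  simp only [zero_add, QuotientAddGroup.mk_zero, fourier_eval_zero, mul_one] at hP
  rw [hF.tsum_eq, ← Complex.ofReal_tsum] at hP
  exact_mod_cast hP

/-! ### Evaluation of the lattice sum. -/

lemma summable_inv_pow_of_one_lt {a : ℝ} (ha : 1 < a) : Summable fun k : ℕ => (a ^ k)⁻¹ := by
  simp_rw [← inv_pow]
  exact summable_geometric_of_lt_one (by positivity) (inv_lt_one_of_one_lt₀ ha)

lemma tsum_inv_pow_of_one_lt {a : ℝ} (ha : 1 < a) : ∑' k : ℕ, (a ^ k)⁻¹ = a / (a - 1) := by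
  simp_rw [← inv_pow]
  rw [tsum_geometric_of_lt_one (by positivity) (inv_lt_one_of_one_lt₀ ha)]
  have : a - 1 ≠ 0 := by linarith
  have : a ≠ 0 := by positivity
  field_simp

lemma summable_planck_pow {a : ℝ} (ha : 1 < a) : Summable fun k : ℕ => planck (a ^ k) :=
  (summable_inv_pow_of_one_lt ha).of_nonneg_of_le (fun _ => planck_nonneg (by positivity))
    fun _ => planck_le_inv (by positivity)

lemma regPlanck_inv_pow {a : ℝ} (ha : 1 < a) (k : ℕ) :
    regPlanck (Real.log a) ((a ^ (k + 1))⁻¹) =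
      1 / 2 * (realCoth ((a ^ (k + 1))⁻¹ / 2) - 2 * a ^ (k + 1)) := by
  have h : (a ^ (k + 1))⁻¹ ≤ Real.exp (-Real.log a) := by
    rw [Real.exp_neg, Real.exp_log (by positivity)]
    exact inv_anti₀ (by positivity) (le_self_pow₀ ha.le (by omega))
  rw [regPlanck, logCutoff_of_le (Real.log_pos ha) (by positivity) h,
    realCoth_half (by positivity), inv_inv]
  ring

lemma summable_realCoth_sub {a : ℝ} (ha : 1 < a) :
    Summable fun k : ℕ => realCoth ((a ^ (k + 1))⁻¹ / 2) - 2 * a ^ (k + 1) := by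
  have hL := Real.log_pos ha
  have h : Summable fun k : ℕ => regPlanck (Real.log a) ((a ^ (k + 1))⁻¹) := by
    refine Summable.of_norm_bounded
      ((summable_nat_add_iff 1).mpr (summable_inv_pow_of_one_lt ha)) fun k => ?_
    refine abs_regPlanck_of_le_exp hL (by positivity) ?_
    rw [Real.exp_neg, Real.exp_log (by positivity)]
    exact inv_anti₀ (by positivity) (le_self_pow₀ ha.le (by omega))
  convert! h.mul_left 2 using 2 with k
  rw [regPlanck_inv_pow ha]
  ring

lemma tsum_regPlanck_exp_eq {a : ℝ} (ha : 1 < a) :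
    ∑' n : ℤ, regPlanck (Real.log a) (Real.exp (-(Real.log a * n))) =
      ∑' k : ℕ, planck (a ^ k) - a / (a - 1) +
        1 / 2 * ∑' k : ℕ, (realCoth ((a ^ (k + 1))⁻¹ / 2) - 2 * a ^ (k + 1)) := by
  have hL := Real.log_pos ha
  have ha0 : 0 < a := by positivity
  -- After reflection, `n ≥ 0` corresponds to `x = a^n ≥ 1`, where the ramp is `0`. The term `n = 0`
  -- belongs here; from `x = a⁻¹` downwards the ramp is `1`.
  rw [← (Equiv.neg ℤ).tsum_eq]
  have hpow : ∀ k : ℕ, Real.exp (Real.log a * k) = a ^ k := fun k => by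
    rw [mul_comm, Real.exp_nat_mul, Real.exp_log ha0]
  have h1 : HasSum (fun k : ℕ => regPlanck (Real.log a)
      (Real.exp (-(Real.log a * ((Equiv.neg ℤ (k : ℤ) : ℤ) : ℝ)))))
      (∑' k : ℕ, planck (a ^ k) - a / (a - 1)) := by
    convert! (summable_planck_pow ha).hasSum.sub (summable_inv_pow_of_one_lt ha).hasSum using 1
    · ext k
      have : -(Real.log a * ((Equiv.neg ℤ (k : ℤ) : ℤ) : ℝ)) = Real.log a * k := by simp
      rw [this, hpow, regPlanck, logCutoff_of_one_le hL (one_le_pow₀ ha.le)]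
      simp
    · rw [tsum_inv_pow_of_one_lt ha]
  have h2 : HasSum (fun k : ℕ => regPlanck (Real.log a)
      (Real.exp (-(Real.log a * ((Equiv.neg ℤ (-(k + 1 : ℤ)) : ℤ) : ℝ)))))
      (1 / 2 * ∑' k : ℕ, (realCoth ((a ^ (k + 1))⁻¹ / 2) - 2 * a ^ (k + 1))) := by
    convert! (summable_realCoth_sub ha).hasSum.mul_left (1 / 2) using 1
    ext k
    have : -(Real.log a * ((Equiv.neg ℤ (-(k + 1 : ℤ)) : ℤ) : ℝ)) =
      -(Real.log a * ((k + 1 : ℕ) : ℝ)) := by simp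
    rw [this, Real.exp_neg, hpow, regPlanck_inv_pow ha]
  exact (HasSum.of_nat_of_neg_add_one (f := fun n : ℤ => regPlanck (Real.log a)
    (Real.exp (-(Real.log a * ((Equiv.neg ℤ n : ℤ) : ℝ))))) h1 h2).tsum_eq

theorem mainTheorem5 (a : ℝ) (ha : 1 < a) :
    Summable (fun k : ℕ => gammaZetaTerm a (k + 1)) ∧
    Summable (fun k : ℕ => 1 / (Real.exp (a ^ k) - 1)) ∧
    Summable (fun k : ℕ => realCoth ((a ^ (k + 1))⁻¹ / 2) - 2 * a ^ (k + 1)) ∧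
    (∑' k : ℕ, gammaZetaTerm a (k + 1)).re =
      -(a * Real.log a / (2 * (a - 1)))
        - (Real.eulerMascheroniConstant - Real.log (2 * Real.pi * Real.sqrt a)) / 4
        + Real.log a / 2 * ∑' k : ℕ, 1 / (Real.exp (a ^ k) - 1)
        + Real.log a / 4 *
            ∑' k : ℕ, (realCoth ((a ^ (k + 1))⁻¹ / 2) - 2 * a ^ (k + 1)) := by
  refine ⟨summable_gammaZetaTerm ha, summable_planck_pow ha, summable_realCoth_sub ha, ?_⟩
  have hL := Real.log_pos ha
  have ha0 : 0 < a := by positivity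
  have ha1 : a - 1 ≠ 0 := by linarith
  have h := (tsum_regPlanck_exp ha).symm.trans (tsum_regPlanck_exp_eq ha)
  -- The `L / 4` from the zeroth coefficient is what turns `log (2π)` into `log (2π√a)`.
  have hlog : Real.log (2 * Real.pi * Real.sqrt a) = Real.log (2 * Real.pi) + Real.log a / 2 := by
    rw [Real.log_mul (by positivity) (by positivity), Real.log_sqrt ha0.le]
  have hS : ∑' k : ℕ, 1 / (Real.exp (a ^ k) - 1) = ∑' k : ℕ, planck (a ^ k) := rfl
  rw [hlog, hS]
  rw [one_div, inv_mul_eq_iff_eq_mul₀ hL.ne'] at h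
  have hdiv : a * Real.log a / (2 * (a - 1)) = 1 / 2 * (Real.log a * (a / (a - 1))) := by
    field_simp
  rw [hdiv]
  linear_combination (1 / 2) * h
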